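/- Let $K$ be any field and let $\omega$ be the exponent of matrix multiplication over $K$, i.e. the smallest constant such that two $n\times n$ matrices over $K$ can be multiplied by straight-line programs with $n^{\omega+o(1)}$ arithmetic operations. Consider randomized word-RAM algorithms with words of $\Theta(\log n)$ bits that are given the number $n$ of vertices and have query access to a simple graph $G$ on the vertex set $\{0,\dots,n-1\}$: in one step the algorithm may get the $i$-th vertex, the degree of a given vertex, or the $j$-th neighbor of a given vertex, where the neighbors of each vertex are listed in an arbitrary order. Let $T$ denote the number of triangles of $G$. Let $\delta\in\mathbb R$ be a constant, and suppose that there is such an algorithm with the following two properties. 1. (Approximation.) There is a constant $c\ge 1$ such that on every graph with $T\ge 1$, and for every order of its neighbor lists, the algorithm outputs with probability at least $2/3$ a natural number $\hat T$ with $T/c\le\hat T\le cT$. 2. (Running time.) On every graph with $n$ vertices and $T\ge 1$ triangles, and for every order of its neighbor lists, the algorithm runs in expected time $\tilde O\big(n^\omega/T^\delta\big)$. Here $\tilde O$ ignores $n^{o(1)}$ factors: there are a constant $C$ and a sequence $e(n)\to 0$, both independent of the graph, such that the expected number of steps is at most $C\,n^{e(n)}\,n^\omega/T^\delta$. Then $\delta\le\omega-2$.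 -/

import Mathlib

open Filter Topology

/-! ### The exponent of matrix multiplication -/

namespace MatMul

variable {σ K : Type*} [Field K]

/-- Operands that may be used after the results in `L` have been computed: these results, the
input variables, and the constants. -/
def Available (L : List (MvPolynomial σ K)) (p : MvPolynomial σ K) : Prop :=
  p ∈ L ∨ (∃ x, p = MvPolynomial.X x) ∨ ∃ a, p = MvPolynomial.C a

/-- Straight-line programs (arithmetic circuits) over `K`, given by the list of their results,
latest result first. Each entry costs one arithmetic operation. -/
inductive IsStraightLine : List (MvPolynomial σ K) → Prop
  | nil : IsStraightLine []
  | add {L : List (MvPolynomial σ K)} {p q : MvPolynomial σ K} :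
      IsStraightLine L → Available L p → Available L q → IsStraightLine ((p + q) :: L)
  | sub {L : List (MvPolynomial σ K)} {p q : MvPolynomial σ K} :
      IsStraightLine L → Available L p → Available L q → IsStraightLine ((p - q) :: L)
  | mul {L : List (MvPolynomial σ K)} {p q : MvPolynomial σ K} :
      IsStraightLine L → Available L p → Available L q → IsStraightLine ((p * q) :: L)

/-- Two (generic) `n × n` matrices over `K` can be multiplied with at most `s` arithmetic
operations. -/
def MultipliableIn (K : Type*) [Field K] (n s : ℕ) : Prop :=
  ∃ L : List (MvPolynomial ((Fin n × Fin n) ⊕ (Fin n × Fin n)) K),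
    IsStraightLine L ∧ L.length ≤ s ∧
    ∀ i j, Available L
      (∑ k, MvPolynomial.X (Sum.inl (i, k)) * MvPolynomial.X (Sum.inr (k, j)))

/-- The exponent `ω` of matrix multiplication over `K`: the smallest `τ` such that two `n × n`
matrices can be multiplied with `O(n ^ (τ + o(1)))` arithmetic operations. -/
noncomputable def exponent (K : Type*) [Field K] : ℝ :=
  sInf {τ : ℝ | ∃ C : ℝ, ∃ e : ℕ → ℝ, Tendsto e atTop (𝓝 0) ∧
    ∀ n : ℕ, ∃ s : ℕ, MultipliableIn K n s ∧ (s : ℝ) ≤ C * (n : ℝ) ^ (τ + e n)}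

end MatMul

/-! ### Graphs given by adjacency lists -/

/-- A graph on the vertices `0, …, n - 1`, with the neighbours of each vertex listed in an
arbitrary order. -/
structure ListedGraph (n : ℕ) where
  graph : SimpleGraph (Fin n)
  nbrs : Fin n → List (Fin n)
  nodup : ∀ v, (nbrs v).Nodup
  mem_nbrs : ∀ u v, u ∈ nbrs v ↔ graph.Adj v u

namespace ListedGraph

variable {n : ℕ} (G : ListedGraph n)

/-- The number of triangles. -/
noncomputable def triangles : ℕ := (G.graph.cliqueSet 3).ncard

/-- Answer to "which is the `i`-th vertex?" (`n` if there is none). -/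
def vertexQuery (_G : ListedGraph n) (i : ℕ) : ℕ := if i < n then i else n

/-- Answer to "what is the degree of the vertex `v`?" (`n` if `v` is not a vertex). -/
def degreeQuery (v : ℕ) : ℕ := if h : v < n then (G.nbrs ⟨v, h⟩).length else n

/-- Answer to "which is the `j`-th neighbour of `v`?", counting from `0`
(`n` if there is none). -/
def neighborQuery (v j : ℕ) : ℕ :=
  if h : v < n then (((G.nbrs ⟨v, h⟩)[j]?).map (fun u : Fin n => (u : ℕ))).getD n else n

end ListedGraph

/-! ### Randomized word RAMs with query access to a graph -/

namespace GraphRAM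

/-- Arithmetic and bitwise operations on words. -/
inductive BinOp
  | add | sub | mul | div | mod | land | lor | xor | shl | shr

/-- The value of an operation on words smaller than `M`; it is reduced modulo `M` when it is
stored. Division by `0` gives `0`. -/
def BinOp.eval (M : ℕ) : BinOp → ℕ → ℕ → ℕ
  | add, x, y => x + y
  | sub, x, y => x + (M - y)
  | mul, x, y => x * y
  | div, x, y => x / y
  | mod, x, y => x % y
  | land, x, y => x &&& y
  | lor, x, y => x ||| y
  | xor, x, y => x ^^^ y
  | shl, x, y => x <<< y
  | shr, x, y => x >>> y

/-- Instructions. `R[a]` is the content of the memory cell with address `a`. -/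
inductive Instr
  /-- `R[d] := c` -/
  | const (d c : ℕ)
  /-- `R[d] := R[a] op R[b]` -/
  | op (o : BinOp) (d a b : ℕ)
  /-- `R[d] := R[R[a]]` -/
  | load (d a : ℕ)
  /-- `R[R[d]] := R[a]` -/
  | store (d a : ℕ)
  /-- go to line `l` if `R[a] < R[b]` -/
  | jumpLt (a b l : ℕ)
  /-- go to line `l` if `R[a] = R[b]` -/
  | jumpEq (a b l : ℕ)
  /-- `R[d] :=` a fresh uniformly random element of `{0, …, R[a]}` -/
  | rand (d a : ℕ)
  /-- `R[d] :=` the `R[a]`-th vertex -/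
  | vertex (d a : ℕ)
  /-- `R[d] :=` the degree of the vertex `R[a]` -/
  | degree (d a : ℕ)
  /-- `R[d] :=` the `R[b]`-th neighbour of the vertex `R[a]` -/
  | neighbor (d a b : ℕ)
  /-- stop with output `R[a]` -/
  | halt (a : ℕ)

/-- An algorithm: one program for all inputs, run on words of `wordFactor * Nat.size n` bits
(that is, of `Θ(log n)` bits) when the input has `n` vertices. -/
structure Algorithm where
  wordFactor : ℕ
  code : List Instr

/-- A configuration: the current line, the memory, and the output once the machine has
halted. -/
structure Config where
  pc : ℕ
  mem : ℕ → ℕ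
  out : Option ℕ

/-- Write the value `x`, reduced to a word, into the cell `d`, and go to the next line. -/
def Config.write (c : Config) (M d x : ℕ) : Config :=
  { c with pc := c.pc + 1, mem := Function.update c.mem d (x % M) }

/-- The number `2 ^ w` of words, for inputs with `n` vertices. -/
def Algorithm.words (A : Algorithm) (n : ℕ) : ℕ := 2 ^ (A.wordFactor * Nat.size n)

/-- Initially the number of vertices stands in cell `0`, and all other cells are `0`. -/
def Algorithm.init (A : Algorithm) (n : ℕ) : Config where
  pc := 0
  mem := Function.update (fun _ => 0) 0 (n % A.words n)
  out := none

/-- The effect of an instruction on a configuration, on words smaller than `M`. -/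
noncomputable def Instr.exec {n : ℕ} (G : ListedGraph n) (M : ℕ) (c : Config) :
    Instr → PMF Config
  | const d x => PMF.pure (c.write M d x)
  | op o d a b => PMF.pure (c.write M d (o.eval M (c.mem a) (c.mem b)))
  | load d a => PMF.pure (c.write M d (c.mem (c.mem a)))
  | store d a => PMF.pure (c.write M (c.mem d) (c.mem a))
  | jumpLt a b l =>
      PMF.pure { c with pc := if c.mem a < c.mem b then l else c.pc + 1 }
  | jumpEq a b l =>
      PMF.pure { c with pc := if c.mem a = c.mem b then l else c.pc + 1 }
  | rand d a =>
      (PMF.uniformOfFintype (Fin (c.mem a + 1))).map (fun x => c.write M d x)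
  | vertex d a => PMF.pure (c.write M d (G.vertexQuery (c.mem a)))
  | degree d a => PMF.pure (c.write M d (G.degreeQuery (c.mem a)))
  | neighbor d a b => PMF.pure (c.write M d (G.neighborQuery (c.mem a) (c.mem b)))
  | halt a => PMF.pure { c with out := some (c.mem a) }

namespace Algorithm

variable (A : Algorithm) {n : ℕ} (G : ListedGraph n)

/-- One step of the computation. A machine that has halted stays in its configuration; so does
one whose current line does not exist, which then never halts. -/
noncomputable def step (c : Config) : PMF Config :=
  match c.out, A.code[c.pc]? with
  | none, some i => i.exec G (A.words n) c
  | _, _ => PMF.pure c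

/-- The distribution of the configuration after `t` steps on the input `G`. -/
noncomputable def run : ℕ → PMF Config
  | 0 => PMF.pure (A.init n)
  | t + 1 => (run t).bind (A.step G)

/-- The probability that the machine halts with an output in `S`. -/
noncomputable def outputProb (S : Set ℕ) : ENNReal :=
  ⨆ t, (A.run G t).toOuterMeasure {c | ∃ x ∈ S, c.out = some x}

/-- The expected number of steps until the machine halts, as the sum over `t` of the
probabilities that it has not halted after `t` steps. -/
noncomputable def expectedTime : ENNReal :=
  ∑' t, (A.run G t).toOuterMeasure {c | c.out = none}

/-- For some constant `c ≥ 1`, on each graph that has a triangle, the output is with probability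
at least `2 / 3` within a factor `c` of the number `T` of triangles. -/
def ApproximatesTriangles : Prop :=
  ∃ c : ℝ, 1 ≤ c ∧ ∀ (n : ℕ) (G : ListedGraph n), 1 ≤ G.triangles →
    2 / 3 ≤ A.outputProb G
      {x : ℕ | (G.triangles : ℝ) / c ≤ (x : ℝ) ∧ (x : ℝ) ≤ c * (G.triangles : ℝ)}

/-- The algorithm runs in expected time `O(n ^ o(1) * f n T)` on graphs with `n` vertices and
`T ≥ 1` triangles. -/
def RunsInSoftO (f : ℕ → ℕ → ℝ) : Prop :=
  ∃ C : ℝ, ∃ e : ℕ → ℝ, Tendsto e atTop (𝓝 0) ∧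
    ∀ (n : ℕ) (G : ListedGraph n), 1 ≤ G.triangles →
      A.expectedTime G ≤ ENNReal.ofReal (C * (n : ℝ) ^ e n * f n G.triangles)

end Algorithm

end GraphRAM

/-! A lower bound of order $n^2$ is proved for graphs with $T=\Theta(n)$ triangles. The base graph
is complete bipartite plus one separate triangle, so $T=1$. Replacing two bipartite edges $ab$,
$a'b'$ by $aa'$, $bb'$ inside the two sides keeps all degrees, alters only four neighbor-list
entries, and creates $\Theta(n)$ triangles, because $aa'$ closes a triangle with almost every vertex
of the other side. There are $m^2=\Theta(n^2)$ places for such a switch, and their sets of altered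
entries are pairwise disjoint. A machine that makes $o(n^2)$ steps on the base graph therefore
misses some place almost surely, and behaves alike on both graphs (`expect_run_le`,
`exists_card_mul_visits_le`). Yet a $c$-approximation must separate $T=1$ from $T=\Theta(n)$, so
some switched graph costs $\Omega(n^2)$ expected steps. Comparing with $n^{\omega-\delta+o(1)}$
gives $\delta\le\omega-2$. -/

/-! ### Expectations under probability mass functions -/

namespace PMF

variable {α β : Type*}

/-- The expectation of a nonnegative function under a probability mass function. -/
noncomputable def expect (p : PMF α) (f : α → ENNReal) : ENNReal := ∑' a, p a * f a

lemma expect_mono (p : PMF α) {f g : α → ENNReal} (h : ∀ a, f a ≤ g a) :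
    p.expect f ≤ p.expect g :=
  ENNReal.tsum_le_tsum fun a => mul_le_mul_right (h a) _

lemma expect_add (p : PMF α) (f g : α → ENNReal) :
    p.expect (fun a => f a + g a) = p.expect f + p.expect g := by
  simp only [expect, mul_add, ENNReal.tsum_add]

lemma expect_one (p : PMF α) : p.expect (fun _ => 1) = 1 := by
  simp [expect, p.tsum_coe]

lemma expect_le_one (p : PMF α) {f : α → ENNReal} (h : ∀ a, f a ≤ 1) : p.expect f ≤ 1 :=
  (p.expect_mono h).trans_eq p.expect_one

lemma expect_pure (a : α) (f : α → ENNReal) : (PMF.pure a).expect f = f a := by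
  rw [expect, tsum_eq_single a]
  · simp
  · intro b hb
    simp [hb]

lemma expect_bind (p : PMF α) (q : α → PMF β) (f : β → ENNReal) :
    (p.bind q).expect f = p.expect fun a => (q a).expect f := by
  simp only [expect, bind_apply, ← ENNReal.tsum_mul_right, ← ENNReal.tsum_mul_left]
  rw [ENNReal.tsum_comm]
  simp only [mul_assoc]

lemma expect_finset_sum {ι : Type*} (p : PMF α) (s : Finset ι) (f : ι → α → ENNReal) :
    p.expect (fun a => ∑ i ∈ s, f i a) = ∑ i ∈ s, p.expect (f i) := by
  simp only [expect, Finset.mul_sum]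
  exact Summable.tsum_finsetSum fun _ _ => ENNReal.summable

lemma toOuterMeasure_eq_expect (p : PMF α) (s : Set α) :
    p.toOuterMeasure s = p.expect (s.indicator 1) := by
  rw [toOuterMeasure_apply, expect]
  refine tsum_congr fun a => ?_
  by_cases h : a ∈ s <;> simp [h]

end PMF

/-! ### Indistinguishability and expected running time -/

namespace GraphRAM.Algorithm

variable (A : Algorithm) {n : ℕ} (G : ListedGraph n)

lemma step_of_out_ne_none {c : Config} (h : c.out ≠ none) : A.step G c = PMF.pure c := by
  unfold step
  split
  · exact absurd ‹_› h
  · rfl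

lemma expect_run_succ (t : ℕ) (f : Config → ENNReal) :
    (A.run G (t + 1)).expect f = (A.run G t).expect fun c => (A.step G c).expect f := by
  rw [run, PMF.expect_bind]

/-- A function that takes its maximal value `1` until the machine halts has decreasing
expectation. -/
lemma antitone_expect_run {f : Config → ENNReal} (h1 : ∀ c, f c ≤ 1)
    (h : ∀ c, c.out = none → f c = 1) : Antitone fun t => (A.run G t).expect f := by
  refine antitone_nat_of_succ_le fun t => ?_
  rw [expect_run_succ]
  refine PMF.expect_mono _ fun c => ?_
  by_cases hc : c.out = none
  · rw [h c hc]
    exact PMF.expect_le_one _ h1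
  · rw [step_of_out_ne_none A G hc, PMF.expect_pure]

/-- A function that vanishes until the machine halts has increasing expectation. -/
lemma monotone_expect_run {f : Config → ENNReal} (h : ∀ c, c.out = none → f c = 0) :
    Monotone fun t => (A.run G t).expect f := by
  refine monotone_nat_of_le_succ fun t => ?_
  rw [expect_run_succ]
  refine PMF.expect_mono _ fun c => ?_
  by_cases hc : c.out = none
  · simp [h c hc]
  · rw [step_of_out_ne_none A G hc, PMF.expect_pure]

/-- The indicator function of the configurations that have not halted. -/
noncomputable def running : Config → ENNReal := Set.indicator {c | c.out = none} 1

/-- The indicator function of the configurations that have halted with an output in `S`. -/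
noncomputable def haltedIn (S : Set ℕ) : Config → ENNReal :=
  Set.indicator {c | ∃ x ∈ S, c.out = some x} 1

lemma haltedIn_of_out_eq_none (S : Set ℕ) {c : Config} (h : c.out = none) :
    haltedIn S c = 0 := by
  simp [haltedIn, h]

lemma running_of_out_eq_none {c : Config} (h : c.out = none) : running c = 1 := by
  simp [running, h]

lemma running_le_one (c : Config) : running c ≤ 1 := Set.indicator_le_self' (by simp) c

lemma haltedIn_le_one (S : Set ℕ) (c : Config) : haltedIn S c ≤ 1 :=
  Set.indicator_le_self' (by simp) c

lemma haltedIn_add_running_le_one (S : Set ℕ) (c : Config) :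
    haltedIn S c + running c ≤ 1 := by
  by_cases h : c.out = none
  · rw [haltedIn_of_out_eq_none S h, zero_add]
    exact running_le_one c
  · have : running c = 0 := by simp [running, h]
    rw [this, add_zero]
    exact haltedIn_le_one S c

lemma haltedIn_add_haltedIn_le_one {S S' : Set ℕ} (hS : Disjoint S S') (c : Config) :
    haltedIn S c + haltedIn S' c ≤ 1 := by
  by_cases h : ∃ x ∈ S, c.out = some x
  · obtain ⟨x, hx, hc⟩ := h
    have : haltedIn S' c = 0 := by
      simp only [haltedIn, Set.indicator_apply_eq_zero, Set.mem_ofPred_eq]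
      rintro ⟨y, hy, hc'⟩
      rw [hc, Option.some_inj] at hc'
      exact absurd (hc' ▸ hy) (Set.disjoint_left.1 hS hx)
    rw [this, add_zero]
    exact haltedIn_le_one S c
  · have : haltedIn S c = 0 := by
      rw [haltedIn, Set.indicator_of_notMem]
      exact h
    rw [this, zero_add]
    exact haltedIn_le_one S' c

lemma outputProb_eq (S : Set ℕ) :
    A.outputProb G S = ⨆ t, (A.run G t).expect (haltedIn S) := by
  simp only [outputProb, PMF.toOuterMeasure_eq_expect, haltedIn]

lemma outputProb_add_le_one {S S' : Set ℕ} (hS : Disjoint S S') :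
    A.outputProb G S + A.outputProb G S' ≤ 1 := by
  rw [outputProb_eq, outputProb_eq, ENNReal.iSup_add_iSup_of_monotone
    (monotone_expect_run A G fun _ => haltedIn_of_out_eq_none S)
    (monotone_expect_run A G fun _ => haltedIn_of_out_eq_none S')]
  refine iSup_le fun t => ?_
  rw [← PMF.expect_add]
  exact PMF.expect_le_one _ (haltedIn_add_haltedIn_le_one hS)

/-- A machine that ever outputs in `S` has either done so by time `t` or is still running then;
formally, the sum of the two indicators has decreasing expectation. -/
lemma outputProb_le (S : Set ℕ) (t : ℕ) :
    A.outputProb G S ≤ (A.run G t).expect (haltedIn S) + (A.run G t).expect running := by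
  rw [outputProb_eq]
  refine iSup_le fun s => ?_
  rcases le_total s t with h | h
  · exact (monotone_expect_run A G (fun _ => haltedIn_of_out_eq_none S) h).trans le_self_add
  · rw [← PMF.expect_add]
    refine (PMF.expect_mono _ fun _ => le_self_add).trans
      (antitone_expect_run A G (f := fun c => haltedIn S c + running c)
        (haltedIn_add_running_le_one S) (fun c hc => ?_) h)
    rw [haltedIn_of_out_eq_none S hc, running_of_out_eq_none hc, zero_add]

/-- Markov's inequality for the running time. -/
lemma mul_expect_running_le (t : ℕ) :
    t * (A.run G t).expect running ≤ A.expectedTime G := by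
  have h : A.expectedTime G = ∑' s, (A.run G s).expect running := by
    simp only [expectedTime, PMF.toOuterMeasure_eq_expect, running]
  rw [h]
  refine le_trans ?_ (ENNReal.sum_le_tsum (Finset.range t))
  rw [← nsmul_eq_mul]
  nth_rw 1 [← Finset.card_range t]
  refine Finset.card_nsmul_le_sum _ _ _ fun s hs => ?_
  exact antitone_expect_run A G running_le_one (fun _ => running_of_out_eq_none)
    (Finset.mem_range.1 hs).le

/-- Two inputs on which the machine behaves in the same way outside a set `D` of configurations
lead to distributions that differ by at most the expected number of visits to `D`. -/
lemma expect_run_le {G' : ListedGraph n} {D : Set Config}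
    (hD : ∀ c ∉ D, A.step G' c = A.step G c) (t : ℕ) {f : Config → ENNReal}
    (hf : ∀ c, f c ≤ 1) :
    (A.run G' t).expect f ≤
      (A.run G t).expect f + ∑ s ∈ Finset.range t, (A.run G s).expect (D.indicator 1) := by
  induction t generalizing f with
  | zero => simp [run]
  | succ t ih =>
    rw [expect_run_succ, expect_run_succ, Finset.sum_range_succ]
    -- Hybrid argument: the induction hypothesis, applied to the expectation of `f` after one more
    -- step on `G'`, moves the first `t` steps to `G`. The last step is then exchanged along the run
    -- on `G`, so only visits of that run are charged.
    refine (ih fun c => PMF.expect_le_one _ hf).trans ?_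
    have key : (A.run G t).expect (fun c => (A.step G' c).expect f) ≤
        (A.run G t).expect (fun c => (A.step G c).expect f) +
          (A.run G t).expect (D.indicator 1) := by
      rw [← PMF.expect_add]
      refine PMF.expect_mono _ fun c => ?_
      by_cases hc : c ∈ D
      · rw [Set.indicator_of_mem hc]
        exact (PMF.expect_le_one _ hf).trans le_add_self
      · rw [hD c hc]
        exact le_self_add
    refine (add_le_add key le_rfl).trans_eq ?_
    rw [add_assoc, add_comm ((A.run G t).expect (D.indicator 1))]

/-- Of pairwise disjoint sets of configurations, some set is visited rarely. -/
lemma exists_card_mul_visits_le {ι : Type*} [Fintype ι] [Nonempty ι] {D : ι → Set Config}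
    (hD : Pairwise fun i j => Disjoint (D i) (D j)) (t : ℕ) :
    ∃ i, (Fintype.card ι : ENNReal) *
      ∑ s ∈ Finset.range t, (A.run G s).expect ((D i).indicator 1) ≤ t := by
  set v : ι → ENNReal := fun i =>
    ∑ s ∈ Finset.range t, (A.run G s).expect ((D i).indicator 1) with hv
  obtain ⟨i, -, hi⟩ := Finset.exists_min_image Finset.univ v Finset.univ_nonempty
  refine ⟨i, ?_⟩
  -- The least visited set lies below the average, and at each time the configuration is in at most
  -- one of the disjoint sets.
  have h1 : (Fintype.card ι : ENNReal) * v i ≤ ∑ j, v j := by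
    rw [← nsmul_eq_mul, ← Finset.card_univ]
    exact Finset.card_nsmul_le_sum _ _ _ hi
  refine h1.trans ?_
  rw [hv, Finset.sum_comm]
  calc _ ≤ ∑ _s ∈ Finset.range t, (1 : ENNReal) := by
        refine Finset.sum_le_sum fun s _ => ?_
        rw [← PMF.expect_finset_sum]
        refine PMF.expect_le_one _ fun c => ?_
        by_cases h : ∃ j, c ∈ D j
        · obtain ⟨j, hj⟩ := h
          rw [Finset.sum_eq_single j]
          · simp [hj]
          · intro k _ hk
            exact Set.indicator_of_notMem (Set.disjoint_right.1 (hD hk) hj) _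
          · simp
        · push Not at h
          simp [h]
    _ = t := by simp

/-- If the machine tells with probability `2 / 3` an input `G` from each input of a family that
differs from `G` on pairwise disjoint sets of configurations, then it takes long on some input of
the family. -/
lemma exists_le_expectedTime {ι : Type*} [Fintype ι] [Nonempty ι] {H : ι → ListedGraph n}
    {D : ι → Set Config} (hD : Pairwise fun i j => Disjoint (D i) (D j))
    (hstep : ∀ i, ∀ c ∉ D i, A.step (H i) c = A.step G c)
    {S : Set ℕ} {S' : ι → Set ℕ} (hS : ∀ i, Disjoint S (S' i))
    (hG : 2 / 3 ≤ A.outputProb G S) (hH : ∀ i, 2 / 3 ≤ A.outputProb (H i) (S' i))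
    {k : ℕ} (hk : 0 < k) (hcard : Fintype.card ι = 36 * k ^ 2) :
    ∃ i, (k : ENNReal) ^ 2 ≤ A.expectedTime (H i) := by
  obtain ⟨i, hi⟩ := A.exists_card_mul_visits_le G hD (6 * k ^ 2)
  refine ⟨i, ?_⟩
  -- With $36k^2$ inputs, $t=6k^2$ makes the visits at most $1/6$. On `G` a wrong output in `S' i`
  -- has probability at most $1/3$, so the machine is still running on `H i` at time $t$ with
  -- probability at least $2/3-1/3-1/6=1/6$, and Markov gives $t/6=k^2$.
  set t := 6 * k ^ 2 with ht
  set v := ∑ s ∈ Finset.range t, (A.run G s).expect ((D i).indicator 1) with hv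
  set r := (A.run (H i) t).expect running with hr
  have hr1 : r ≤ 1 := PMF.expect_le_one _ running_le_one
  have h1 : (A.run (H i) t).expect (haltedIn (S' i)) ≤ A.outputProb G (S' i) + v := by
    refine (A.expect_run_le G (hstep i) t (haltedIn_le_one _)).trans ?_
    gcongr
    rw [outputProb_eq]
    exact le_iSup (fun t => (A.run G t).expect (haltedIn (S' i))) t
  have h2 : 2 / 3 ≤ A.outputProb G (S' i) + v + r :=
    ((hH i).trans (A.outputProb_le (H i) (S' i) t)).trans (by gcongr)
  have h3 := A.outputProb_add_le_one G (hS i)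
  have h4 := A.mul_expect_running_le (H i) t
  have hv1 : v ≤ 1 / 6 := by
    rw [hcard] at hi
    have hk0 : ((t : ℕ) : ENNReal) ≠ 0 := by positivity
    rw [ENNReal.le_div_iff_mul_le (by simp) (by simp)]
    have : (t : ENNReal) * (v * 6) ≤ t * 1 := by
      calc (t : ENNReal) * (v * 6) = ((36 * k ^ 2 : ℕ) : ENNReal) * v := by
            rw [ht]; push_cast; ring
        _ ≤ t * 1 := by rw [mul_one]; exact hi
    exact (ENNReal.mul_le_mul_iff_right hk0 (ENNReal.natCast_ne_top t)).1 this
  have hx1 : A.outputProb G S ≤ 1 := le_self_add.trans h3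
  have hy1 : A.outputProb G (S' i) ≤ 1 := le_add_self.trans h3
  have hr6 : 1 / 6 ≤ r := by
    generalize A.outputProb G S = x at *
    generalize A.outputProb G (S' i) = y at *
    have hv' : v ≤ 1 := hv1.trans (by simp)
    lift x to NNReal using (hx1.trans_lt ENNReal.one_lt_top).ne
    lift y to NNReal using (hy1.trans_lt ENNReal.one_lt_top).ne
    clear_value v r
    lift v to NNReal using (hv'.trans_lt ENNReal.one_lt_top).ne
    lift r to NNReal using (hr1.trans_lt ENNReal.one_lt_top).ne
    have e1 : (2 / 3 : ENNReal) = ((2 / 3 : NNReal) : ENNReal) := by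
      rw [ENNReal.coe_div (by simp)]; simp
    have e2 : (1 / 6 : ENNReal) = ((1 / 6 : NNReal) : ENNReal) := by
      rw [ENNReal.coe_div (by simp)]; simp
    rw [e1] at h2 hG
    rw [e2] at hv1 ⊢
    norm_cast at h2 hG hv1 h3 ⊢
    rw [← NNReal.coe_le_coe] at h2 hG hv1 h3 ⊢
    push_cast at h2 hG hv1 h3 ⊢
    linarith
  refine le_trans ?_ h4
  calc (k : ENNReal) ^ 2 = k ^ 2 * (6 * (1 / 6)) := by
        rw [ENNReal.mul_div_cancel (by simp) (by simp), mul_one]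
    _ = (t : ENNReal) * (1 / 6) := by rw [ht]; push_cast; ring
    _ ≤ t * r := by gcongr

end GraphRAM.Algorithm

/-! ### Switching two edges inside the neighbor lists -/

namespace ListedGraph

variable {n : ℕ}

/-- Any graph with its neighbours listed in some order. -/
noncomputable def ofGraph (G : SimpleGraph (Fin n)) : ListedGraph n := by
  classical
  exact
  { graph := G
    nbrs := fun v => (G.neighborFinset v).toList
    nodup := fun v => Finset.nodup_toList _
    mem_nbrs := fun u v => by simp }

/-- The conditions under which the edges `ab`, `a'b'` may be replaced by `aa'`, `bb'`. -/
structure Switchable (G : SimpleGraph (Fin n)) (a b a' b' : Fin n) : Prop where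
  ne_left : a ≠ a'
  ne_right : b ≠ b'
  adj : G.Adj a b
  adj' : G.Adj a' b'
  not_adj_left : ¬ G.Adj a a'
  not_adj_right : ¬ G.Adj b b'

/-- The permutation of the neighbours of `v` when `ab`, `a'b'` are replaced by `aa'`, `bb'`. -/
def switchPerm (a b a' b' v : Fin n) : Equiv.Perm (Fin n) :=
  if v = a then Equiv.swap b a' else if v = a' then Equiv.swap b' a
  else if v = b then Equiv.swap a b' else if v = b' then Equiv.swap a' b else Equiv.refl _

/-- The neighbour `u` of `v` that is replaced when `ab`, `a'b'` are replaced by `aa'`, `bb'`. -/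
def IsSwitched (a b a' b' v u : Fin n) : Prop :=
  (v = a ∧ u = b) ∨ (v = b ∧ u = a) ∨ (v = a' ∧ u = b') ∨ (v = b' ∧ u = a')

/-- The graph in which the edges `ab`, `a'b'` are replaced by `aa'`, `bb'`. -/
def switchGraph (G : SimpleGraph (Fin n)) (a b a' b' : Fin n) : SimpleGraph (Fin n) where
  Adj v u := v ≠ u ∧ (G.Adj v u ∧ ¬ IsSwitched a b a' b' v u ∨ IsSwitched a a' b b' v u)
  symm := ⟨fun v u => by
    have := G.adj_comm v u
    unfold IsSwitched
    tauto⟩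
  loopless := ⟨fun v h => h.1 rfl⟩

/-- At each of the four vertices the transposition exchanges a neighbor with a non-neighbor, so it
replaces a single list entry in place. -/
lemma mem_map_switchPerm {G : ListedGraph n} {a b a' b' : Fin n}
    (h : Switchable G.graph a b a' b') (v u : Fin n) :
    u ∈ (G.nbrs v).map (switchPerm a b a' b' v) ↔
      (switchGraph G.graph a b a' b').Adj v u := by
  have hm : u ∈ (G.nbrs v).map (switchPerm a b a' b' v) ↔
      G.graph.Adj v ((switchPerm a b a' b' v).symm u) := by
    rw [← G.mem_nbrs, List.mem_map]
    constructor
    · rintro ⟨w, hw, rfl⟩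
      simpa using hw
    · intro hw
      exact ⟨_, hw, by simp⟩
  rw [hm]
  obtain ⟨h1, h2, h3, h4, h5, h6⟩ := h
  have h3' := h3.symm
  have h4' := h4.symm
  have h5' := fun e => h5 (SimpleGraph.Adj.symm e)
  have h6' := fun e => h6 (SimpleGraph.Adj.symm e)
  have n1 := h3.ne
  have n2 := h4.ne
  -- The non-adjacency conditions force the four vertices to be distinct.
  have n3 : a ≠ b' := fun e => h6' (e ▸ h3)
  have n4 : a' ≠ b := fun e => h6 (e ▸ h4)
  have hl : ∀ x, ¬ G.graph.Adj x x := fun x => G.graph.irrefl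
  simp only [switchGraph, switchPerm, IsSwitched]
  split_ifs <;>
    simp only [Equiv.symm_swap, Equiv.swap_apply_def, Equiv.refl_symm,
      Equiv.refl_apply] <;> grind

/-- Replace the edges `ab`, `a'b'` by `aa'`, `bb'`, keeping all degrees and all other entries of
the neighbour lists. -/
def switch (G : ListedGraph n) {a b a' b' : Fin n} (h : Switchable G.graph a b a' b') :
    ListedGraph n where
  graph := switchGraph G.graph a b a' b'
  nbrs v := (G.nbrs v).map (switchPerm a b a' b' v)
  nodup v := (G.nodup v).map (switchPerm a b a' b' v).injective
  mem_nbrs u v := mem_map_switchPerm h v u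

lemma degreeQuery_switch (G : ListedGraph n) {a b a' b' : Fin n}
    (h : Switchable G.graph a b a' b') (v : ℕ) :
    (G.switch h).degreeQuery v = G.degreeQuery v := by
  simp [degreeQuery, switch]

/-- The `j`-th neighbour of `v` is replaced when `ab`, `a'b'` are replaced by `aa'`, `bb'`. -/
def IsSwitchedQuery (G : ListedGraph n) (a b a' b' : Fin n) (v j : ℕ) : Prop :=
  ∃ (hv : v < n) (u : Fin n), (G.nbrs ⟨v, hv⟩)[j]? = some u ∧ IsSwitched a b a' b' ⟨v, hv⟩ u

lemma neighborQuery_switch (G : ListedGraph n) {a b a' b' : Fin n}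
    (h : Switchable G.graph a b a' b') {v j : ℕ} (hj : ¬ IsSwitchedQuery G a b a' b' v j) :
    (G.switch h).neighborQuery v j = G.neighborQuery v j := by
  unfold neighborQuery
  split_ifs with hv
  · simp only [switch, List.getElem?_map]
    cases hu : (G.nbrs ⟨v, hv⟩)[j]? with
    | none => rfl
    | some u =>
      have hs : ¬ IsSwitched a b a' b' ⟨v, hv⟩ u := fun hs => hj ⟨hv, u, hu, hs⟩
      have hadj : G.graph.Adj ⟨v, hv⟩ u := (G.mem_nbrs _ _).1 (List.mem_of_getElem? hu)
      have : switchPerm a b a' b' ⟨v, hv⟩ u = u := by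
        generalize (⟨v, hv⟩ : Fin n) = w at *
        obtain ⟨h1, h2, h3, h4, h5, h6⟩ := h
        have h5' := fun e => h5 (SimpleGraph.Adj.symm e)
        have h6' := fun e => h6 (SimpleGraph.Adj.symm e)
        simp only [switchPerm]
        unfold IsSwitched at hs
        split_ifs <;> simp only [Equiv.swap_apply_def, Equiv.refl_apply] <;> grind
      simp [this]
  · rfl

end ListedGraph

/-! ### Steps of the machine that can notice a switch -/

namespace GraphRAM.Algorithm

variable (A : Algorithm) {n : ℕ}

/-- The configurations that are about to ask for a replaced entry of the neighbour lists. -/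
def switchedConfigs (G : ListedGraph n) (a b a' b' : Fin n) : Set Config :=
  {c | ∃ d x y, A.code[c.pc]? = some (Instr.neighbor d x y) ∧
    G.IsSwitchedQuery a b a' b' (c.mem x) (c.mem y)}

lemma step_switch (G : ListedGraph n) {a b a' b' : Fin n}
    (h : ListedGraph.Switchable G.graph a b a' b') {c : Config}
    (hc : c ∉ A.switchedConfigs G a b a' b') : A.step (G.switch h) c = A.step G c := by
  unfold step
  cases c.out with
  | some x => rfl
  | none =>
    cases hi : A.code[c.pc]? with
    | none => rfl
    | some i =>
      cases i <;> try rfl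
      · simp only [Instr.exec, ListedGraph.degreeQuery_switch]
      · simp only [Instr.exec]
        rw [ListedGraph.neighborQuery_switch G h fun hq => hc ⟨_, _, _, hi, hq⟩]

end GraphRAM.Algorithm

/-! ### A bipartite graph with a hidden switch -/

namespace HiddenSwitch

open ListedGraph

/-- Complete bipartite between the even and the odd vertices below `4 * m`, with a triangle on the
other three vertices. -/
def baseGraph (m : ℕ) : SimpleGraph (Fin (4 * m + 3)) where
  Adj u v := (u.val < 4 * m ∧ v.val < 4 * m ∧ u.val % 2 ≠ v.val % 2) ∨
    (4 * m ≤ u.val ∧ 4 * m ≤ v.val ∧ u ≠ v)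
  symm := ⟨fun u v => by rintro (h | h) <;> [left; right] <;> [omega; exact ⟨h.2.1, h.1, h.2.2.symm⟩]⟩
  loopless := ⟨fun u => by rintro (h | h) <;> simp at h⟩

variable {m : ℕ}

/-- The vertex `4 * i + r`. -/
def vert (i : Fin m) (r : Fin 4) : Fin (4 * m + 3) := ⟨4 * i + r, by omega⟩

/-- The three vertices outside the bipartite part. -/
def outer (m : ℕ) : Finset (Fin (4 * m + 3)) := Finset.univ.filter fun v => 4 * m ≤ v.val

lemma card_outer : (outer m).card = 3 := by
  have : outer m = {⟨4 * m, by omega⟩, ⟨4 * m + 1, by omega⟩, ⟨4 * m + 2, by omega⟩} := by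
    ext v
    simp only [outer, Finset.mem_filter, Finset.mem_univ, true_and, Finset.mem_insert,
      Finset.mem_singleton, Fin.ext_iff]
    omega
  rw [this]
  rw [Finset.card_insert_of_notMem, Finset.card_insert_of_notMem, Finset.card_singleton] <;>
    simp [Fin.ext_iff]

/-- The base graph with its neighbour lists. -/
noncomputable def base (m : ℕ) : ListedGraph (4 * m + 3) := ofGraph (baseGraph m)

lemma cliqueSet_base : (base m).graph.cliqueSet 3 = {outer m} := by
  ext s
  simp only [SimpleGraph.mem_cliqueSet_iff, Set.mem_singleton_iff]
  constructor
  · intro hs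
    refine Finset.eq_of_subset_of_card_le ?_ (by rw [card_outer, hs.card_eq])
    obtain ⟨x, y, z, hxy, hxz, hyz, rfl⟩ := SimpleGraph.is3Clique_iff.1 hs
    simp only [base, ofGraph, baseGraph] at hxy hxz hyz
    intro v hv
    simp only [Finset.mem_insert, Finset.mem_singleton] at hv
    simp only [outer, Finset.mem_filter, Finset.mem_univ, true_and]
    rcases hv with rfl | rfl | rfl <;> omega
  · rintro rfl
    refine ⟨fun u hu v hv huv => Or.inr ?_, card_outer⟩
    simp only [outer, Finset.coe_filter, Finset.mem_univ, true_and, Set.mem_ofPred_eq] at hu hv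
    exact ⟨hu, hv, huv⟩

/-- The separate triangle is needed because the approximation guarantee covers only graphs with
$T\ge1$. -/
lemma triangles_base : (base m).triangles = 1 := by
  rw [triangles, cliqueSet_base, Set.ncard_singleton]

lemma switchable (p : Fin m × Fin m) : Switchable (base m).graph
    (vert p.1 0) (vert p.2 1) (vert p.1 2) (vert p.2 3) := by
  constructor <;> simp [base, ofGraph, baseGraph, vert] <;> omega

/-- The base graph with a switch in the place given by `p`. -/
noncomputable def switched (p : Fin m × Fin m) : ListedGraph (4 * m + 3) :=
  (base m).switch (switchable p)

lemma exists_eq_insert_insert_singleton {α : Type*} [DecidableEq α] {s : Finset α}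
    (hs : s.card = 3) {a b : α} (ha : a ∈ s) (hb : b ∈ s) (hab : a ≠ b) :
    ∃ x, s = {a, b, x} := by
  have hb' : b ∈ s.erase a := Finset.mem_erase.2 ⟨hab.symm, hb⟩
  have h : ((s.erase a).erase b).card = 1 := by
    rw [Finset.card_erase_of_mem hb', Finset.card_erase_of_mem ha, hs]
  obtain ⟨x, hx⟩ := Finset.card_eq_one.1 h
  exact ⟨x, by rw [← hx, Finset.insert_erase hb', Finset.insert_erase ha]⟩

/-- A triangle using neither new edge is a triangle of the base graph, hence the outer one; any
other is determined by a new edge and a third vertex. This gives $1+2n\le 3n$ for $n=4m+3$. -/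
lemma triangles_switched_le (p : Fin m × Fin m) :
    (switched p).triangles ≤ 3 * (4 * m + 3) := by
  classical
  set f : Fin 2 × Fin (4 * m + 3) → Finset (Fin (4 * m + 3)) := fun q =>
    if q.1 = 0 then {vert p.1 0, vert p.1 2, q.2} else {vert p.2 1, vert p.2 3, q.2} with hf
  have hsub : (switched p).graph.cliqueSet 3 ⊆
      ((insert (outer m) (Finset.univ.image f) : Finset _) : Set _) := by
    intro s hs
    rw [SimpleGraph.mem_cliqueSet_iff] at hs
    rw [Finset.coe_insert, Finset.coe_image, Finset.coe_univ, Set.image_univ]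
    by_cases h0 : vert p.1 0 ∈ s ∧ vert p.1 2 ∈ s
    · right
      obtain ⟨x, hx⟩ := exists_eq_insert_insert_singleton hs.card_eq h0.1 h0.2
        (switchable p).ne_left
      exact ⟨(0, x), by simp [hf, hx]⟩
    by_cases h1 : vert p.2 1 ∈ s ∧ vert p.2 3 ∈ s
    · right
      obtain ⟨x, hx⟩ := exists_eq_insert_insert_singleton hs.card_eq h1.1 h1.2
        (switchable p).ne_right
      exact ⟨(1, x), by simp [hf, hx]⟩
    left
    have hb : s ∈ (base m).graph.cliqueSet 3 := by
      refine ⟨fun u hu v hv huv => ?_, hs.card_eq⟩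
      obtain ⟨-, h | h⟩ := hs.isClique hu hv huv
      · exact h.1
      · rw [Finset.mem_coe] at hu hv
        rcases h with ⟨rfl, rfl⟩ | ⟨rfl, rfl⟩ | ⟨rfl, rfl⟩ | ⟨rfl, rfl⟩
        exacts [absurd ⟨hu, hv⟩ h0, absurd ⟨hv, hu⟩ h0, absurd ⟨hu, hv⟩ h1,
          absurd ⟨hv, hu⟩ h1]
    rwa [cliqueSet_base] at hb
  refine (Set.ncard_le_ncard hsub (Finset.finite_toSet _)).trans ?_
  rw [Set.ncard_coe_finset]
  refine (Finset.card_insert_le _ _).trans ?_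
  have := Finset.card_image_le (s := Finset.univ) (f := f)
  simp only [Finset.card_univ, Fintype.card_prod, Fintype.card_fin] at this
  omega

/-- The new edge between `vert p.1 0` and `vert p.1 2` forms a triangle with each `vert k 1` except
for `k = p.2`, whose edge to `vert p.1 0` was removed. -/
lemma le_triangles_switched (p : Fin m × Fin m) : m - 1 ≤ (switched p).triangles := by
  classical
  set f : Fin m → Finset (Fin (4 * m + 3)) := fun k =>
    {vert p.1 0, vert p.1 2, vert k 1} with hf
  have hinj : Function.Injective f := by
    intro k l hkl
    have hk : vert k 1 ∈ f l := by rw [← hkl]; simp [hf]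
    simp only [hf, vert, Finset.mem_insert, Finset.mem_singleton, Fin.ext_iff] at hk
    norm_num at hk
    omega
  have hsub : (((Finset.univ.erase p.2).image f : Finset _) : Set _) ⊆
      (switched p).graph.cliqueSet 3 := by
    intro s hs
    rw [Finset.mem_coe, Finset.mem_image] at hs
    obtain ⟨k, hk, rfl⟩ := hs
    have hk' : (k : ℕ) ≠ p.2 := fun h => (Finset.mem_erase.1 hk).1 (Fin.ext h)
    rw [SimpleGraph.mem_cliqueSet_iff, SimpleGraph.is3Clique_iff]
    refine ⟨_, _, _, ?_, ?_, ?_, rfl⟩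
    · exact ⟨(switchable p).ne_left, Or.inr (Or.inl ⟨rfl, rfl⟩)⟩
    · simp [switched, switch, switchGraph, IsSwitched, base, ofGraph, baseGraph, vert]
      omega
    · simp [switched, switch, switchGraph, IsSwitched, base, ofGraph, baseGraph, vert]
      omega
  have := Set.ncard_le_ncard hsub (Set.toFinite _)
  rwa [Set.ncard_coe_finset, Finset.card_image_of_injective _ hinj,
    Finset.card_erase_of_mem (Finset.mem_univ _), Finset.card_fin] at this

/-- A removed edge has its even end in block `p.1` and its odd end in block `p.2`, so it reveals
both coordinates of `p`. -/
lemma isSwitched_unique {p q : Fin m × Fin m} {v u : Fin (4 * m + 3)}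
    (hp : IsSwitched (vert p.1 0) (vert p.2 1) (vert p.1 2) (vert p.2 3) v u)
    (hq : IsSwitched (vert q.1 0) (vert q.2 1) (vert q.1 2) (vert q.2 3) v u) : p = q := by
  simp only [IsSwitched, vert, Fin.ext_iff] at hp hq
  norm_num at hp hq
  ext <;> omega

/-- A configuration about to make a neighbor query determines the entry asked for, and this entry
belongs to at most one switch. -/
lemma disjoint_switchedConfigs (A : GraphRAM.Algorithm) : Pairwise fun p q : Fin m × Fin m =>
    Disjoint (A.switchedConfigs (base m) (vert p.1 0) (vert p.2 1) (vert p.1 2) (vert p.2 3))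
      (A.switchedConfigs (base m) (vert q.1 0) (vert q.2 1) (vert q.1 2) (vert q.2 3)) := by
  intro p q hpq
  refine Set.disjoint_left.2 fun c hp hq => hpq ?_
  obtain ⟨d, x, y, h, hv, u, hu, hs⟩ := hp
  obtain ⟨d', x', y', h', hv', u', hu', hs'⟩ := hq
  rw [h, Option.some_inj, GraphRAM.Instr.neighbor.injEq] at h'
  obtain ⟨-, rfl, rfl⟩ := h'
  rw [hu, Option.some_inj] at hu'
  subst hu'
  exact isSwitched_unique hs hs'

end HiddenSwitch

/-! ### The quadratic lower bound with linearly many triangles -/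

namespace HiddenSwitch

/-- Taking $m=6k$ yields the $36k^2$ places needed. Since $c^2<k$, accepted outputs are at most $c$
on the base graph and at least $k/c>c$ on a switched one. As $n=24k+3\le27k$, the factor $27$ serves
both bounds on $T$. -/
lemma exists_le_expectedTime (A : GraphRAM.Algorithm) {c : ℝ} (hc : 1 ≤ c)
    (happrox : ∀ (n : ℕ) (G : ListedGraph n), 1 ≤ G.triangles → 2 / 3 ≤ A.outputProb G
      {x : ℕ | (G.triangles : ℝ) / c ≤ (x : ℝ) ∧ (x : ℝ) ≤ c * (G.triangles : ℝ)})
    {k : ℕ} (hk : 0 < k) (hck : c ^ 2 < k) :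
    ∃ G : ListedGraph (24 * k + 3), 1 ≤ G.triangles ∧ (24 * k + 3 : ℝ) / 27 ≤ G.triangles ∧
      (G.triangles : ℝ) ≤ 27 * (24 * k + 3) ∧ (k : ENNReal) ^ 2 ≤ A.expectedTime G := by
  have hlow : ∀ p : Fin (6 * k) × Fin (6 * k), k ≤ (switched p).triangles := fun p => by
    have := le_triangles_switched p
    omega
  have : NeZero (6 * k) := ⟨by omega⟩
  have hdisj : ∀ p : Fin (6 * k) × Fin (6 * k),
      Disjoint {x : ℕ | ((base (6 * k)).triangles : ℝ) / c ≤ (x : ℝ) ∧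
        (x : ℝ) ≤ c * ((base (6 * k)).triangles : ℝ)}
      {x : ℕ | ((switched p).triangles : ℝ) / c ≤ (x : ℝ) ∧
        (x : ℝ) ≤ c * ((switched p).triangles : ℝ)} := fun p => by
    refine Set.disjoint_left.2 fun x hx hx' => ?_
    have hT : (k : ℝ) ≤ (switched p).triangles := by exact_mod_cast hlow p
    have h1 := hx.2
    have h2 := hx'.1
    rw [triangles_base, Nat.cast_one, mul_one] at h1
    rw [div_le_iff₀ (by linarith)] at h2
    nlinarith
  obtain ⟨p, hp⟩ := A.exists_le_expectedTime (base (6 * k)) (H := switched)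
    (disjoint_switchedConfigs A) (fun p c hc => A.step_switch _ (switchable p) hc)
    hdisj (happrox _ _ triangles_base.ge)
    (fun p => happrox _ _ (hk.trans_le (hlow p))) hk
    (by simp only [Fintype.card_prod, Fintype.card_fin]; ring)
  have h24 : 4 * (6 * k) + 3 = 24 * k + 3 := by ring
  have hup := triangles_switched_le p
  have hlo := hlow p
  generalize (switched p) = G at *
  have hk1 : (1 : ℝ) ≤ k := by exact_mod_cast hk
  have hlo' : (k : ℝ) ≤ G.triangles := by exact_mod_cast hlo
  have hup' : (G.triangles : ℝ) ≤ 3 * (4 * (6 * k) + 3) := by exact_mod_cast hup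
  revert G
  rw [h24]
  intro G hp hup hlo hlo' hup'
  exact ⟨G, by omega, by linarith, by linarith, hp⟩

end HiddenSwitch

/-! ### Comparison of exponents -/

/-- A number within a constant factor of `x` has powers within a constant factor of those of
`x`. -/
lemma Real.rpow_le_mul_rpow_of_comparable {x T b : ℝ} (hx : 0 < x) (hb : 1 ≤ b) (h1 : x / b ≤ T)
    (h2 : T ≤ b * x) (δ : ℝ) : x ^ δ ≤ b ^ |δ| * T ^ δ := by
  have hb0 : 0 < b := by linarith
  have hT : 0 < T := (div_pos hx hb0).trans_le h1
  -- The lower bound on `T` matters for $\delta\ge0$, the upper bound for $\delta\le0$.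
  rcases le_total 0 δ with h | h
  · rw [abs_of_nonneg h, ← Real.mul_rpow hb0.le hT.le]
    exact Real.rpow_le_rpow hx.le (by rwa [div_le_iff₀' hb0] at h1) h
  · rw [abs_of_nonpos h, Real.rpow_neg hb0.le, ← Real.inv_rpow hb0.le,
      ← Real.mul_rpow (by positivity) hT.le]
    refine Real.rpow_le_rpow_of_nonpos (by positivity) ?_ h
    rwa [inv_mul_le_iff₀ hb0]

theorem mainTheorem9 (K : Type*) [Field K] (δ : ℝ) (A : GraphRAM.Algorithm)
    (happrox : A.ApproximatesTriangles)
    (htime : A.RunsInSoftO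
      (fun n T : ℕ => (n : ℝ) ^ MatMul.exponent K / (T : ℝ) ^ δ)) :
    δ ≤ MatMul.exponent K - 2 := by
  obtain ⟨c, hc, happrox⟩ := happrox
  obtain ⟨C, e, he, htime⟩ := htime
  -- No property of the exponent is needed; the argument works for every real $\omega$.
  generalize MatMul.exponent K = ω at *
  by_contra! hlt
  -- Half the supposed gap, so that $2=2\eta+\omega-\delta$: one factor $n^\eta$ absorbs $n^{e(n)}$,
  -- the other outgrows the constant `B`.
  set η := (δ - (ω - 2)) / 2 with hη
  have hη0 : 0 < η := by linarith
  set B := 27 ^ 2 * (|C| * 27 ^ |δ|) with hB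
  have hn : Tendsto (fun k : ℕ => 24 * k + 3) atTop atTop :=
    tendsto_atTop_mono (fun k => show k ≤ _ by omega) tendsto_id
  have h1 : ∀ᶠ k : ℕ in atTop, e (24 * k + 3) < η := (he.comp hn).eventually_lt_const hη0
  have h2 : ∀ᶠ k : ℕ in atTop, B < ((24 * k + 3 : ℕ) : ℝ) ^ η :=
    ((tendsto_rpow_atTop hη0).comp
      (tendsto_natCast_atTop_atTop.comp hn)).eventually_gt_atTop B
  have h3 : ∀ᶠ k : ℕ in atTop, c ^ 2 < (k : ℝ) :=
    tendsto_natCast_atTop_atTop.eventually_gt_atTop _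
  obtain ⟨k, hk1, hk2, hk3, hk0⟩ := (h1.and (h2.and (h3.and (eventually_gt_atTop 0)))).exists
  obtain ⟨G, hG1, hGlo, hGup, hG⟩ :=
    HiddenSwitch.exists_le_expectedTime A hc happrox hk0 hk3
  have hle := hG.trans (htime _ G hG1)
  have hcast : ((24 * k + 3 : ℕ) : ℝ) = 24 * k + 3 := by push_cast; ring
  have hk1' : (1 : ℝ) ≤ k := by exact_mod_cast hk0
  have hkn : ((24 * k + 3 : ℕ) : ℝ) ≤ 27 * k := by rw [hcast]; linarith
  rw [← hcast] at hGlo hGup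
  set x : ℝ := ((24 * k + 3 : ℕ) : ℝ) with hx
  have hx1 : 1 ≤ x := by rw [hcast]; linarith
  have hx0 : 0 < x := by linarith
  set T : ℝ := (G.triangles : ℝ)
  have hT0 : 0 < T := lt_of_lt_of_le (by positivity) hGlo
  have hbound : C * x ^ e (24 * k + 3) * (x ^ ω / T ^ δ) ≤
      |C| * x ^ η * (27 ^ |δ| * x ^ (ω - δ)) := by
    have hpow : x ^ ω / T ^ δ ≤ 27 ^ |δ| * x ^ (ω - δ) := by
      have := Real.rpow_le_mul_rpow_of_comparable hx0 (by norm_num) hGlo hGup δ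
      rw [div_le_iff₀ (by positivity), Real.rpow_sub hx0]
      calc x ^ ω = x ^ ω / x ^ δ * x ^ δ := by field_simp
        _ ≤ x ^ ω / x ^ δ * (27 ^ |δ| * T ^ δ) := by gcongr
        _ = _ := by ring
    have hC : C ≤ |C| := le_abs_self C
    have hxe : x ^ e (24 * k + 3) ≤ x ^ η := Real.rpow_le_rpow_of_exponent_le hx1 hk1.le
    gcongr
  have hreal : (k : ℝ) ^ 2 ≤ |C| * x ^ η * (27 ^ |δ| * x ^ (ω - δ)) := by
    have h := hle.trans (ENNReal.ofReal_le_ofReal hbound)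
    rw [← ENNReal.ofReal_natCast, ← ENNReal.ofReal_pow (by positivity)] at h
    exact (ENNReal.ofReal_le_ofReal_iff (by positivity)).1 h
  have hsplit : x ^ 2 = x ^ η * x ^ η * x ^ (ω - δ) := by
    rw [← Real.rpow_add hx0, ← Real.rpow_add hx0, ← Real.rpow_natCast]
    congr 1
    rw [hη]
    push_cast
    ring
  have hfin : x ^ η * (x ^ η * x ^ (ω - δ)) ≤ B * (x ^ η * x ^ (ω - δ)) :=
    calc _ = x ^ 2 := by rw [hsplit]; ring
      _ ≤ (27 * k) ^ 2 := by gcongr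
      _ = 27 ^ 2 * (k : ℝ) ^ 2 := by ring
      _ ≤ 27 ^ 2 * (|C| * x ^ η * (27 ^ |δ| * x ^ (ω - δ))) := by gcongr
      _ = _ := by rw [hB]; ring
  exact absurd (le_of_mul_le_mul_right hfin (by positivity)) (not_le.2 hk2)
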